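/- **Setting.** Let $a,b,\gamma,k_i,k_e>0$, $I=(1,2)$, $h(\ell)=a\ell e^{-b/\ell}$, $g(\ell)=h(\ell)-\ell^2/4$, and $H(r)=2(1-1/r)$, so that $\partial_rH=2/r^2$. Let $L^2(I)$ and $H^k(I)$ carry the norms with weight $r^2$, $\|u\|_{H^k}^2=\sum_{j=0}^k\int_1^2 r^2|\partial_r^ju|^2\,dr$, and let $$X=\{(\rho_i,R_e,V)\in H^1(I)\times H^2(I)\times H^3(I):\ \rho_i(1)=R_e(1)=V(1)=V(2)=0\}.$$ For $\lambda>0$ and $(\rho_i,R_e,V)\in X$ write $\Phi=V+\lambda H$ and $\rho_e=R_ee^{-\lambda H/2}$. A *steady state* is a $(\lambda,\rho_i,R_e,V)\in(0,\infty)\times X$ with, almost everywhere in $I$ for the first three equations, $$\frac{k_i}{r^2}\partial_r\{r^2\rho_i\,\partial_r\Phi\}=k_eh(|\partial_r\Phi|)e^{-\lambda H/2}R_e,$$ $$-\frac1{r^2}\partial_r(r^2\partial_rR_e)-\partial_rV\,\partial_rR_e+\Big\{\frac\lambda2\partial_rV\,\partial_rH-\frac1{r^2}\partial_r(r^2\partial_rV)+\frac{\lambda^2}4|\partial_rH|^2-h(|\partial_r\Phi|)\Big\}R_e=0,$$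 $$\frac1{r^2}\partial_r(r^2\partial_rV)=\rho_i-e^{-\lambda H/2}R_e,$$ $$\Big[\partial_rR_e+\Big(\frac\lambda2\partial_rH+\partial_rV\Big)R_e-\gamma\frac{k_i}{k_e}e^{\lambda H/2}\,\partial_r\Phi\,\rho_i\Big]_{r=2}=0.$$ Let $\mathscr O=\{(\lambda,\rho_i,R_e,V)\in(0,\infty)\times X:\ |\partial_rV+\lambda\partial_rH|>0\text{ on }[1,2]\}$. **Sparking voltage.** The *electron system* at $\lambda>0$ for $\varphi_e\in H^2(I)$ is $-\frac1{r^2}\partial_r(r^2\partial_r\varphi_e)-g(\lambda\partial_rH)\varphi_e=0$ in $I$, $\varphi_e(1)=0$, $\varphi_e>0$ in $I$, and $$\partial_r\varphi_e(2)+\frac\lambda4\varphi_e(2)-a\gamma\frac\lambda2e^{-\lambda/2}\int_1^2e^{-\frac{br^2}{2\lambda}}e^{\lambda/r}\varphi_e\,dr=0.$$ Assume that it is solvable for some $\lambda>0$, and let the sparking voltage $\lambda^\dagger$ be the infimum of all such $\lambda$. Assume the transversality condition at $\lambda=\lambda^\dagger$: $$-\gamma e^{\frac\lambda2}\int_1^2r^2\psi_e(2)\Big\{h'(\lambda\partial_rH)\partial_rH-h(\lambda\partial_rH)\frac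 H2\Big\}e^{-\frac\lambda2H}\varphi_e\,dr-\int_1^2r^2\psi_e\,g'(\lambda\partial_rH)\,\partial_rH\,\varphi_e\,dr+\psi_e(2)\Big\{\varphi_e(2)-2\partial_r\varphi_e(2)-\frac\lambda2\varphi_e(2)\Big\}\ne0,$$ where $\varphi_e$ solves the electron system and $\psi_e\in H^2(I)$ solves $-\frac1{r^2}\partial_r(r^2\partial_r\psi_e)-g(\lambda\partial_rH)\psi_e-h(\lambda\partial_rH)e^{-\frac\lambda2H}\gamma e^{\frac\lambda2}\psi_e(2)=0$ in $I$, $\psi_e(1)=0=\partial_r\psi_e(2)+\frac\lambda4\psi_e(2)$ (such $\varphi_e$, $\psi_e$ are unique up to constant factors; the condition means that some choice gives a nonzero value). **The global curve.** Let $\mathscr K(s)=(\lambda(s),\rho_i(s),R_e(s),V(s))$, $s\in\mathbb R$, be the global bifurcation curve, that is, a continuous curve of steady states in $\mathscr O\subset\mathbb R\times X$ such that: - (C1) $\mathscr K(0)=(\lambda^\dagger,0,0,0)$; - (C2) $(\rho_i,R_e,V)(s)=s(\varphi_i^\dagger,\varphi_e^\dagger,\varphi_v^\dagger)+o(s)$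 in $X$ as $s\to0$, where $(\varphi_i^\dagger,\varphi_e^\dagger,\varphi_v^\dagger)\in X$ spans the nullspace of the linearization of the steady state system with respect to $(\rho_i,R_e,V)$ at $(\lambda^\dagger,0,0,0)$, and $\varphi_i^\dagger,\varphi_e^\dagger>0$ on $(1,2]$; - (C3) for some neighbourhood $\mathscr W\subset\mathscr O$ of $(\lambda^\dagger,0,0,0)$ and some $0<\varepsilon<1$, the steady states in $\mathscr W$ with $(\rho_i,R_e,V)\ne(0,0,0)$ are exactly the points $\mathscr K(s)$, $0<|s|<\varepsilon$; - (C4) $\mathscr K$ has a real-analytic reparametrization locally around each of its points: for each $s_0\in\mathbb R$ there is a continuous injective $\sigma:(-1,1)\to\mathbb R$ with $\sigma(0)=s_0$ such that $\mathscr K\circ\sigma$ is real-analytic; - (C5) at least one of the following holds: (a) $\liminf_{s\to\infty}\lambda(s)=0$; (b) $\liminf_{s\to\infty}\inf_{r\in I}\partial_r\Phi(s,r)=0$; (c) $\limsup_{s\to\infty}(\|\rho_i\|_{H^1}+\|R_e\|_{H^2}+\|V\|_{H^3}+\lambda)(s)=\infty$; (d) $\mathscr K(s+T)=\mathscr K(s)$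 for all $s\in\mathbb R$, for some $T>0$. **Proposition 6.1.** Assume $\gamma(1+\gamma)^{-1}\ne e^{-a}$ and the global positivity alternative: $\rho_i(s,r)>0$ and $\rho_e(s,r)>0$ for all $s>0$ and $r\in(1,2]$, and $$\limsup_{s\to\infty}\{\|\rho_i(s)\|_{C^0}+\|\rho_e(s)\|_{C^0}+\lambda(s)\}=\infty.$$ If $\limsup_{s\to\infty}\{\|\rho_i(s)\|_{C^0}+\|\rho_e(s)\|_{C^0}\}<\infty$, then $$\liminf_{s\to\infty}\{\|\rho_i(s)\|_{C^0}+\|\rho_e(s)\|_{L^1}\}=0\qquad\text{and}\qquad\limsup_{s\to\infty}\lambda(s)=\infty,$$ where $C^0=C^0([1,2])$ and $L^1=L^1(1,2)$. -/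

import Mathlib

open MeasureTheory Filter Set Topology Asymptotics
open scoped ContDiff

noncomputable section

namespace GasDischarge

/-! ### Radial Sobolev spaces on `I = (1, 2)` -/

/-- The measure `r² dr` on `I = (1, 2)`. -/
def radialMeasure : Measure ℝ :=
  (volume.restrict (Ioo (1 : ℝ) 2)).withDensity (fun r => ENNReal.ofReal (r ^ 2))

/-- `L²(I)` with the inner product `⟨u, v⟩ = ∫ r² u v dr`. -/
abbrev L2I : Type := Lp ℝ 2 radialMeasure

/-- `f` and `g` are integrable on `I`, and `g` is the weak derivative of `f` on `I`. -/
def HasWeakDeriv (f g : ℝ → ℝ) : Prop :=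
  IntegrableOn f (Ioo (1 : ℝ) 2) ∧ IntegrableOn g (Ioo (1 : ℝ) 2) ∧
    ∀ φ : ℝ → ℝ, ContDiff ℝ ∞ φ → HasCompactSupport φ → tsupport φ ⊆ Ioo (1 : ℝ) 2 →
      ∫ r in Ioo (1 : ℝ) 2, f r * deriv φ r = -∫ r in Ioo (1 : ℝ) 2, g r * φ r

lemma ae_radialMeasure {P : ℝ → Prop} (hP : ∀ᵐ r ∂radialMeasure, P r) :
    ∀ᵐ r ∂(volume.restrict (Ioo (1 : ℝ) 2)), P r := by
  have hm : Measurable (fun r : ℝ => ENNReal.ofReal (r ^ 2)) := by fun_prop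
  have h := (ae_withDensity_iff hm).1 hP
  filter_upwards [h, ae_restrict_mem measurableSet_Ioo] with r hr hI
  have h1 : (0 : ℝ) < r ^ 2 := by
    have := hI.1
    positivity
  exact hr (ENNReal.ofReal_pos.2 h1).ne'

lemma HasWeakDeriv.congr {f f' g g' : ℝ → ℝ} (h : HasWeakDeriv f g)
    (hf : f =ᵐ[volume.restrict (Ioo (1 : ℝ) 2)] f')
    (hg : g =ᵐ[volume.restrict (Ioo (1 : ℝ) 2)] g') : HasWeakDeriv f' g' := by
  refine ⟨h.1.congr hf, h.2.1.congr hg, fun φ h1 h2 h3 => ?_⟩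
  have e1 : ∫ r in Ioo (1 : ℝ) 2, f r * deriv φ r = ∫ r in Ioo (1 : ℝ) 2, f' r * deriv φ r :=
    integral_congr_ae (by filter_upwards [hf] with r hr; rw [hr])
  have e2 : ∫ r in Ioo (1 : ℝ) 2, g r * φ r = ∫ r in Ioo (1 : ℝ) 2, g' r * φ r :=
    integral_congr_ae (by filter_upwards [hg] with r hr; rw [hr])
  rw [← e1, ← e2]
  exact h.2.2 φ h1 h2 h3

lemma integrable_mul_test {f φ : ℝ → ℝ} (hf : IntegrableOn f (Ioo (1 : ℝ) 2))
    (hφ : Continuous φ) (hc : HasCompactSupport φ) :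
    IntegrableOn (fun r => f r * φ r) (Ioo (1 : ℝ) 2) := by
  obtain ⟨C, hC⟩ := hc.exists_bound_of_continuous hφ
  exact hf.mul_bdd (c := C) hφ.aestronglyMeasurable (Eventually.of_forall hC)

lemma HasWeakDeriv.add {f f' g g' : ℝ → ℝ} (h : HasWeakDeriv f g) (h' : HasWeakDeriv f' g') :
    HasWeakDeriv (f + f') (g + g') := by
  refine ⟨h.1.add h'.1, h.2.1.add h'.2.1, fun φ h1 h2 h3 => ?_⟩
  have hd : Continuous (deriv φ) := h1.continuous_deriv (by norm_num)
  simp only [Pi.add_apply, add_mul]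
  rw [integral_add (integrable_mul_test h.1 hd h2.deriv) (integrable_mul_test h'.1 hd h2.deriv),
    integral_add (integrable_mul_test h.2.1 h1.continuous h2)
      (integrable_mul_test h'.2.1 h1.continuous h2), h.2.2 φ h1 h2 h3, h'.2.2 φ h1 h2 h3]
  ring

lemma HasWeakDeriv.smul {f g : ℝ → ℝ} (c : ℝ) (h : HasWeakDeriv f g) :
    HasWeakDeriv (c • f) (c • g) := by
  refine ⟨h.1.smul c, h.2.1.smul c, fun φ h1 h2 h3 => ?_⟩
  simp only [Pi.smul_apply, smul_eq_mul, mul_assoc, integral_const_mul]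
  rw [h.2.2 φ h1 h2 h3]
  ring

/-- `H^k(I)`: an element is the tuple `(u, ∂u, …, ∂^k u)` of a function and its weak derivatives,
all in `L²(I)`. The norm is the one of `⟨u, v⟩ = ∑_{j ≤ k} ∫ r² (∂^j u) (∂^j v) dr`. -/
def sobolev (k : ℕ) : Submodule ℝ (PiLp 2 (fun _ : Fin (k + 1) => L2I)) where
  carrier := {u | ∀ j : Fin k, HasWeakDeriv (u j.castSucc) (u j.succ)}
  zero_mem' := by
    intro j
    have h0 : (fun _ => (0 : ℝ)) =ᵐ[volume.restrict (Ioo (1 : ℝ) 2)] ((0 : L2I) : ℝ → ℝ) := by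
      filter_upwards [ae_radialMeasure (Lp.coeFn_zero ℝ 2 radialMeasure)] with r hr
      rw [hr]; rfl
    have hz : HasWeakDeriv (fun _ => (0 : ℝ)) (fun _ => (0 : ℝ)) :=
      ⟨integrableOn_zero, integrableOn_zero, fun φ _ _ _ => by simp⟩
    exact hz.congr h0 h0
  add_mem' := by
    intro u v hu hv j
    refine ((hu j).add (hv j)).congr ?_ ?_
    · exact (ae_radialMeasure (Lp.coeFn_add (u j.castSucc) (v j.castSucc))).mono
        fun r hr => hr.symm
    · exact (ae_radialMeasure (Lp.coeFn_add (u j.succ) (v j.succ))).mono fun r hr => hr.symm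
  smul_mem' := by
    intro c u hu j
    refine ((hu j).smul c).congr ?_ ?_
    · exact (ae_radialMeasure (Lp.coeFn_smul c (u j.castSucc))).mono fun r hr => hr.symm
    · exact (ae_radialMeasure (Lp.coeFn_smul c (u j.succ))).mono fun r hr => hr.symm

/-- `f` is continuous on `[1, 2]` and equal to `w` almost everywhere on `I`. -/
def IsContRep (f w : ℝ → ℝ) : Prop :=
  ContinuousOn f (Icc 1 2) ∧ f =ᵐ[volume.restrict (Ioo (1 : ℝ) 2)] w

open Classical in
/-- The continuous representative of `w` on `[1, 2]`. On `[1, 2]` it is uniquely determined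
whenever it exists, as it does for functions in `H¹(I)`. -/
def contRep (w : ℝ → ℝ) : ℝ → ℝ :=
  if h : ∃ f, IsContRep f w then h.choose else 0

/-- For `u ∈ H^k(I)` and `j < k`, the continuous function `∂^j u` on `[1, 2]`. -/
def D {k : ℕ} (u : sobolev k) (j : Fin k) : ℝ → ℝ :=
  contRep (u.1 j.castSucc)

/-- The trace of `w` at `r ∈ [1, 2]` is zero. -/
def VanishesAt (w : ℝ → ℝ) (r : ℝ) : Prop :=
  ∃ f, IsContRep f w ∧ f r = 0

lemma vanishesAt_zero (r : ℝ) : VanishesAt ((0 : L2I) : ℝ → ℝ) r := by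
  refine ⟨fun _ => 0, ⟨continuousOn_const, ?_⟩, rfl⟩
  filter_upwards [ae_radialMeasure (Lp.coeFn_zero ℝ 2 radialMeasure)] with r hr
  rw [hr]; rfl

lemma VanishesAt.add {u v : L2I} {r : ℝ} (hu : VanishesAt u r) (hv : VanishesAt v r) :
    VanishesAt ((u + v : L2I) : ℝ → ℝ) r := by
  obtain ⟨f, ⟨hf, hfu⟩, hfr⟩ := hu
  obtain ⟨g, ⟨hg, hgv⟩, hgr⟩ := hv
  refine ⟨f + g, ⟨hf.add hg, ?_⟩, by simp [hfr, hgr]⟩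
  filter_upwards [hfu, hgv, ae_radialMeasure (Lp.coeFn_add u v)] with t h1 h2 h3
  rw [h3, Pi.add_apply, Pi.add_apply, h1, h2]

lemma VanishesAt.smul {u : L2I} {r : ℝ} (c : ℝ) (hu : VanishesAt u r) :
    VanishesAt ((c • u : L2I) : ℝ → ℝ) r := by
  obtain ⟨f, ⟨hf, hfu⟩, hfr⟩ := hu
  refine ⟨c • f, ⟨hf.const_smul c, ?_⟩, by simp [hfr]⟩
  filter_upwards [hfu, ae_radialMeasure (Lp.coeFn_smul c u)] with t h1 h2
  rw [h2, Pi.smul_apply, Pi.smul_apply, h1]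

/-- The space `X` of triples `(ρ_i, R_e, V) ∈ H¹(I) × H²(I) × H³(I)` with
`ρ_i(1) = R_e(1) = V(1) = V(2) = 0`, with the (equivalent) maximum norm of the product. -/
def X : Submodule ℝ (sobolev 1 × sobolev 2 × sobolev 3) where
  carrier := {u | VanishesAt (u.1.1 0) 1 ∧ VanishesAt (u.2.1.1 0) 1 ∧
    VanishesAt (u.2.2.1 0) 1 ∧ VanishesAt (u.2.2.1 0) 2}
  zero_mem' := ⟨vanishesAt_zero 1, vanishesAt_zero 1, vanishesAt_zero 1, vanishesAt_zero 2⟩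
  add_mem' := fun hu hv =>
    ⟨hu.1.add hv.1, hu.2.1.add hv.2.1, hu.2.2.1.add hv.2.2.1, hu.2.2.2.add hv.2.2.2⟩
  smul_mem' := fun c _ hu =>
    ⟨hu.1.smul c, hu.2.1.smul c, hu.2.2.1.smul c, hu.2.2.2.smul c⟩

/-- The component `ρ_i ∈ H¹(I)` of a triple in `X`. -/
def ionOf (u : X) : sobolev 1 := u.1.1

/-- The component `R_e ∈ H²(I)` of a triple in `X`. -/
def elecOf (u : X) : sobolev 2 := u.1.2.1

/-- The component `V ∈ H³(I)` of a triple in `X`. -/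
def potOf (u : X) : sobolev 3 := u.1.2.2

/-- The `C⁰([1, 2])` norm. -/
def c0Norm (f : ℝ → ℝ) : ℝ := sSup ((fun r => |f r|) '' Icc (1 : ℝ) 2)

/-- The `L¹(1, 2)` norm. -/
def l1Norm (f : ℝ → ℝ) : ℝ := ∫ r in Ioo (1 : ℝ) 2, |f r|

/-! ### The stationary ionization model -/

/-- The positive physical constants `a, b, γ, k_i, k_e`. -/
structure Params where
  (a b γ ki ke : ℝ)
  a_pos : 0 < a
  b_pos : 0 < b
  γ_pos : 0 < γ
  ki_pos : 0 < ki
  ke_pos : 0 < ke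

/-- The harmonic function `H` with `H = 0` at `r = 1` and `H = 1` at `r = 2`. -/
def H (r : ℝ) : ℝ := 2 * (1 - 1 / r)

/-- The derivative `∂_r H`. -/
def dH (r : ℝ) : ℝ := 2 / r ^ 2

namespace Params

/-- `h(ℓ) = a ℓ e^{-b/ℓ}`. -/
def h (p : Params) (ℓ : ℝ) : ℝ := p.a * ℓ * Real.exp (-p.b / ℓ)

/-- `g(ℓ) = h(ℓ) - ℓ²/4`. -/
def g (p : Params) (ℓ : ℝ) : ℝ := p.h ℓ - ℓ ^ 2 / 4

end Params

/-- `∂_r Φ = ∂_r V + λ ∂_r H` on `[1, 2]`. -/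
def dPhi (lam : ℝ) (u : X) (r : ℝ) : ℝ := D (potOf u) 1 r + lam * dH r

/-- The ion density `ρ_i` on `[1, 2]`. -/
def rhoI (u : X) (r : ℝ) : ℝ := D (ionOf u) 0 r

/-- The electron density `ρ_e = R_e e^{-λH/2}` on `[1, 2]`. -/
def rhoE (lam : ℝ) (u : X) (r : ℝ) : ℝ := D (elecOf u) 0 r * Real.exp (-(lam / 2) * H r)

/-- The system `𝓕_j(λ, ρ_i, R_e, V) = 0`, `j = 1, 2, 3, 4`. The first three equations hold almost
everywhere in `I` and are multiplied by `r²`; the derivatives `∂_r(r² ρ_i ∂_r Φ)`, `∂_r(r² ∂_r R_e)`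
and `∂_r(r² ∂_r V)` are weak derivatives. -/
structure IsSteadyState (p : Params) (lam : ℝ) (u : X) : Prop where
  eq1 : HasWeakDeriv
    (fun r => p.ki * (r ^ 2 * D (ionOf u) 0 r * dPhi lam u r))
    (fun r => r ^ 2 * (p.ke * p.h |dPhi lam u r| * Real.exp (-(lam / 2) * H r) * D (elecOf u) 0 r))
  eq2 : HasWeakDeriv
    (fun r => r ^ 2 * D (elecOf u) 1 r)
    (fun r => r ^ 2 * (-(D (potOf u) 1 r * D (elecOf u) 1 r)
      + (lam / 2 * D (potOf u) 1 r * dH r - (D (potOf u) 2 r + 2 / r * D (potOf u) 1 r)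
        + lam ^ 2 / 4 * dH r ^ 2 - p.h |dPhi lam u r|) * D (elecOf u) 0 r))
  eq3 : HasWeakDeriv
    (fun r => r ^ 2 * D (potOf u) 1 r)
    (fun r => r ^ 2 * (D (ionOf u) 0 r - Real.exp (-(lam / 2) * H r) * D (elecOf u) 0 r))
  eq4 : D (elecOf u) 1 2 + (lam / 2 * dH 2 + D (potOf u) 1 2) * D (elecOf u) 0 2
    - p.γ * (p.ki / p.ke) * Real.exp (lam / 2 * H 2) * dPhi lam u 2 * D (ionOf u) 0 2 = 0

/-- The open set `𝒪 ⊆ (0, ∞) × X` where `|∂_r V + λ ∂_r H| > 0` on `[1, 2]`. -/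
def admissible : Set (ℝ × X) :=
  {z | 0 < z.1 ∧ ∀ r ∈ Icc (1 : ℝ) 2, 0 < |dPhi z.1 z.2 r|}

/-! ### Sparking voltage and transversality -/

/-- `φ ∈ H²(I)` solves the electron system at voltage `λ`. -/
structure SolvesElectronSystem (p : Params) (lam : ℝ) (φ : sobolev 2) : Prop where
  ode : HasWeakDeriv (fun r => r ^ 2 * D φ 1 r) (fun r => -(r ^ 2 * (p.g (lam * dH r) * D φ 0 r)))
  left : D φ 0 1 = 0
  pos : ∀ r ∈ Ioo (1 : ℝ) 2, 0 < D φ 0 r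
  right : D φ 1 2 + lam / 4 * D φ 0 2
    - p.a * p.γ * (lam / 2) * Real.exp (-(lam / 2)) *
      ∫ r in (1 : ℝ)..2, Real.exp (-(p.b * r ^ 2 / (2 * lam))) * Real.exp (lam / r) * D φ 0 r = 0

/-- The voltages `λ > 0` at which the electron system has a solution. -/
def sparkingSet (p : Params) : Set ℝ :=
  {lam | 0 < lam ∧ ∃ φ : sobolev 2, SolvesElectronSystem p lam φ}

/-- The sparking voltage exists: `(a, b, γ) ∈ 𝒮`. -/
def HasSparkingVoltage (p : Params) : Prop := (sparkingSet p).Nonempty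

/-- The sparking voltage `λ†`. -/
def sparkingVoltage (p : Params) : ℝ := sInf (sparkingSet p)

/-- `ψ ∈ H²(I)` solves the adjoint problem at voltage `λ`. -/
structure SolvesAdjoint (p : Params) (lam : ℝ) (ψ : sobolev 2) : Prop where
  ode : HasWeakDeriv (fun r => r ^ 2 * D ψ 1 r)
    (fun r => -(r ^ 2 * (p.g (lam * dH r) * D ψ 0 r
      + p.h (lam * dH r) * Real.exp (-(lam / 2) * H r) * p.γ * Real.exp (lam / 2) * D ψ 0 2)))
  left : D ψ 0 1 = 0
  right : D ψ 1 2 + lam / 4 * D ψ 0 2 = 0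

/-- The number `F(a, b, γ)` computed with `λ`, `φ_e = φ` and `ψ_e = ψ`. -/
def transversalityNumber (p : Params) (lam : ℝ) (φ ψ : sobolev 2) : ℝ :=
  -(p.γ * Real.exp (lam / 2) * ∫ r in (1 : ℝ)..2, r ^ 2 * D ψ 0 2 *
      (deriv p.h (lam * dH r) * dH r - p.h (lam * dH r) * (H r / 2)) *
      Real.exp (-(lam / 2) * H r) * D φ 0 r)
    - (∫ r in (1 : ℝ)..2, r ^ 2 * D ψ 0 r * deriv p.g (lam * dH r) * dH r * D φ 0 r)
    + D ψ 0 2 * (D φ 0 2 - 2 * D φ 1 2 - lam / 2 * D φ 0 2)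

/-- The transversality condition `F(a, b, γ) ≠ 0` at `λ = λ†`. The solutions `φ_e` and `ψ_e` are
unique up to constant factors. -/
def Transversality (p : Params) : Prop :=
  ∃ φ ψ : sobolev 2, SolvesElectronSystem p (sparkingVoltage p) φ ∧
    SolvesAdjoint p (sparkingVoltage p) ψ ∧
    transversalityNumber p (sparkingVoltage p) φ ψ ≠ 0

/-- `(S_i, S_e, W) ∈ X` is in the nullspace of the linearization
`𝓛 = ∂_{(ρ_i, R_e, V)} 𝓕(λ, 0, 0, 0)`. -/
structure InNullspace (p : Params) (lam : ℝ) (w : X) : Prop where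
  eq1 : HasWeakDeriv (fun r => 2 * p.ki * lam * D (ionOf w) 0 r)
    (fun r => r ^ 2 * (p.ke * p.h (lam * dH r) * Real.exp (-(lam / 2) * H r) * D (elecOf w) 0 r))
  eq2 : HasWeakDeriv (fun r => r ^ 2 * D (elecOf w) 1 r)
    (fun r => -(r ^ 2 * (p.g (lam * dH r) * D (elecOf w) 0 r)))
  eq3 : HasWeakDeriv (fun r => r ^ 2 * D (potOf w) 1 r)
    (fun r => r ^ 2 * (D (ionOf w) 0 r - Real.exp (-(lam / 2) * H r) * D (elecOf w) 0 r))
  eq4 : D (elecOf w) 1 2 + lam / 4 * D (elecOf w) 0 2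
    - p.γ * (p.ki / p.ke) * Real.exp (lam / 2) * (lam / 2) * D (ionOf w) 0 2 = 0

/-! ### The global bifurcation curve -/

/-- `K(s) = (λ(s), ρ_i(s), R_e(s), V(s))` is the global bifurcation curve, in some
parametrization: a continuous curve of steady states in `𝒪` with the properties (C1)–(C5). -/
structure IsGlobalCurve (p : Params) (K : ℝ → ℝ × X) : Prop where
  continuous : Continuous K
  mem : ∀ s, K s ∈ admissible
  steady : ∀ s, IsSteadyState p (K s).1 (K s).2
  c1 : K 0 = (sparkingVoltage p, 0)
  c2 : ∃ w : X, (∀ v : X, InNullspace p (sparkingVoltage p) v ↔ ∃ c : ℝ, v = c • w) ∧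
    (∀ r ∈ Ioc (1 : ℝ) 2, 0 < D (ionOf w) 0 r ∧ 0 < D (elecOf w) 0 r) ∧
    (fun s => (K s).2 - s • w) =o[𝓝 0] (fun s : ℝ => s)
  c3 : ∃ W ∈ 𝓝 ((sparkingVoltage p, 0) : ℝ × X), W ⊆ admissible ∧ ∃ ε : ℝ, 0 < ε ∧ ε < 1 ∧
    {z | z ∈ W ∧ z.2 ≠ 0 ∧ IsSteadyState p z.1 z.2} = K '' {s | 0 < |s| ∧ |s| < ε}
  c4 : ∀ s₀, ∃ σ : ℝ → ℝ, σ 0 = s₀ ∧ ContinuousOn σ (Ioo (-1) 1) ∧ InjOn σ (Ioo (-1) 1) ∧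
    AnalyticOnNhd ℝ (fun t => K (σ t)) (Ioo (-1) 1)
  c5 : liminf (fun s => ((K s).1 : EReal)) atTop = 0 ∨
    liminf (fun s => ⨅ r ∈ Ioo (1 : ℝ) 2, ((dPhi (K s).1 (K s).2 r : ℝ) : EReal)) atTop = 0 ∨
    limsup (fun s => ((‖ionOf (K s).2‖ + ‖elecOf (K s).2‖ + ‖potOf (K s).2‖ + (K s).1 : ℝ) : EReal))
      atTop = ⊤ ∨
    ∃ T : ℝ, 0 < T ∧ ∀ s, K s = K (s + T)

/-- The global positivity alternative: both densities are positive on `(1, 2]` for all `s > 0`, and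
`limsup_{s → ∞} (‖ρ_i‖_{C⁰} + ‖ρ_e‖_{C⁰} + λ) = ∞`. -/
def PositiveAlternative (K : ℝ → ℝ × X) : Prop :=
  (∀ s > 0, ∀ r ∈ Ioc (1 : ℝ) 2, 0 < rhoI (K s).2 r ∧ 0 < rhoE (K s).1 (K s).2 r) ∧
  limsup (fun s => ((c0Norm (rhoI (K s).2) + c0Norm (rhoE (K s).1 (K s).2) + (K s).1 : ℝ) : EReal))
    atTop = ⊤

end GasDischarge

end

noncomputable section

namespace GasDischarge

/-! ### Weak derivatives and continuous representatives -/

/-! If both densities stay bounded, the positivity alternative forces `limsup λ = ∞`. The other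
limit follows from the decay estimate `exists_decay_of_bounded`: a positive steady state with
densities bounded by `M` satisfies `‖ρ_i‖_{C⁰} + ‖ρ_e‖_{L¹} ≤ C / λ` once `λ` is large, with `C`
independent of `λ`.

For the decay, a bounded space charge gives `r² ∂_rΦ = 2λ + O(M)` (`IsSteadyState.abs_dPhi_sub_le`).
Let `J` be the ion flux, `E` the electron flux and `A = J(2) / k_e`. Ionization transfers current
from `E` to `J`, so `E + J / k_e` is constant; with `J(1) = 0` and the cathode condition, `E(2) = γ
A` and `E(1) = (1 + γ) A`.

The crux is `IsSteadyState.abs_ionFlux_two_le`. In a strong field `h(ℓ) = aℓ + O(1)`, so `E' ≈ -a E`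
and `e^{ar} E` is conserved up to an error controlled by `M` alone. Comparing the endpoints bounds
`A (e^{2a} γ - e^a (1 + γ))` uniformly in `λ`, and the assumption on `γ` says exactly that the
factor is nonzero. Hence `A` is bounded, while `J` carries a factor of order `λ` times `ρ_i` and
`J'` one of order `λ` times `ρ_e`.

The weak-derivative lemmas turn the equations into classical pointwise ones, so that the mean value
theorem applies. -/

/-- A test function on `I` with vanishing integral is the derivative of a test function on `I`. -/
lemma exists_test_primitive {ψ : ℝ → ℝ} (hψ : ContDiff ℝ ∞ ψ) (hc : HasCompactSupport ψ)
    (hs : tsupport ψ ⊆ Ioo (1 : ℝ) 2) (h0 : ∫ r in (1 : ℝ)..2, ψ r = 0) :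
    ∃ φ : ℝ → ℝ, ContDiff ℝ ∞ φ ∧ HasCompactSupport φ ∧ tsupport φ ⊆ Ioo (1 : ℝ) 2 ∧
      deriv φ = ψ := by
  have hcont : Continuous ψ := hψ.continuous
  have hder : ∀ r, HasDerivAt (fun x => ∫ t in (1 : ℝ)..x, ψ t) (ψ r) r := fun r =>
    (hcont.integral_hasStrictDerivAt 1 r).hasDerivAt
  obtain ⟨c, d, hc1, hd2, hcd⟩ : ∃ c d : ℝ, 1 < c ∧ d < 2 ∧ tsupport ψ ⊆ Icc c d := by
    rcases (tsupport ψ).eq_empty_or_nonempty with he | hne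
    · exact ⟨3 / 2, 3 / 2, by norm_num, by norm_num, by simp [he]⟩
    · obtain ⟨c, hcm, hcl⟩ := hc.isCompact.exists_isLeast hne
      obtain ⟨d, hdm, hdl⟩ := hc.isCompact.exists_isGreatest hne
      exact ⟨c, d, (hs hcm).1, (hs hdm).2, fun x hx => ⟨hcl hx, hdl hx⟩⟩
  have hzero : ∀ x, x ∉ Icc c d → ψ x = 0 := fun x hx =>
    image_eq_zero_of_notMem_tsupport fun h => hx (hcd h)
  have hint : ∀ u v : ℝ, IntervalIntegrable ψ volume u v := fun u v => hcont.intervalIntegrable u v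
  have hsupp : Function.support (fun x => ∫ t in (1 : ℝ)..x, ψ t) ⊆ Icc c d := by
    intro x hx
    by_contra hxc
    apply hx
    rw [mem_Icc, not_and_or, not_le, not_le] at hxc
    rcases hxc with hxc | hxd
    · refine (intervalIntegral.integral_congr (g := fun _ => 0) fun t ht => hzero t ?_).trans
        (by simp)
      intro h
      rcases le_max_iff.1 ht.2 with h1 | h1 <;> linarith [h.1]
    -- To the right of the support the primitive equals the full integral over `[1, 2]`, which
    -- vanishes by `h0`.
    · have : ∫ t in (2 : ℝ)..x, ψ t = 0 := by
        refine (intervalIntegral.integral_congr (g := fun _ => 0) fun t ht => hzero t ?_).trans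
          (by simp)
        intro h
        rcases min_le_iff.1 ht.1 with h1 | h1 <;> linarith [h.2]
      change ∫ t in (1 : ℝ)..x, ψ t = 0
      rw [← intervalIntegral.integral_add_adjacent_intervals (hint 1 2) (hint 2 x), h0, this,
        add_zero]
  have hts : tsupport (fun x => ∫ t in (1 : ℝ)..x, ψ t) ⊆ Icc c d :=
    closure_minimal hsupp isClosed_Icc
  have hderiv : deriv (fun x => ∫ t in (1 : ℝ)..x, ψ t) = ψ := funext fun r => (hder r).deriv
  refine ⟨fun x => ∫ t in (1 : ℝ)..x, ψ t, ?_, ?_, fun x hx => ?_, hderiv⟩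
  · refine contDiff_infty_iff_deriv.2 ⟨fun r => (hder r).differentiableAt, ?_⟩
    rwa [hderiv]
  · exact HasCompactSupport.of_support_subset_isCompact isCompact_Icc hsupp
  · exact ⟨hc1.trans_le (hts hx).1, (hts hx).2.trans_lt hd2⟩

/-- The du Bois-Reymond lemma on `I`. -/
lemma ae_eq_const_of_weakDeriv_zero {f : ℝ → ℝ} (hf : HasWeakDeriv f 0) :
    ∃ c : ℝ, f =ᵐ[volume.restrict (Ioo (1 : ℝ) 2)] fun _ => c := by
  obtain ⟨χ, hχs, hχc, hχd, hχr, hχ1⟩ :=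
    exists_contDiff_tsupport_subset (E := ℝ) (n := ⊤) (x := 3 / 2)
      (Ioo_mem_nhds (a := 1) (b := 2) (by norm_num : (1 : ℝ) < 3 / 2) (by norm_num))
  have hconv : ∀ g : ℝ → ℝ, ∫ r in Ioo (1 : ℝ) 2, g r = ∫ r in (1 : ℝ)..2, g r := fun g => by
    rw [intervalIntegral.integral_of_le one_le_two, integral_Ioc_eq_integral_Ioo]
  have hχpos : 0 < ∫ r in (1 : ℝ)..2, χ r := by
    refine intervalIntegral.integral_pos one_lt_two hχd.continuous.continuousOn
      (fun x _ => (hχr (mem_range_self x)).1) ⟨3 / 2, by norm_num, by rw [hχ1]; norm_num⟩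
  set m := ∫ r in (1 : ℝ)..2, χ r with hm
  -- The constant is the `χ`-weighted mean of `f`; division by `m` replaces normalizing the bump.
  set c := (∫ r in Ioo (1 : ℝ) 2, f r * χ r) / m with hcdef
  refine ⟨c, ?_⟩
  have key : ∀ᵐ x : ℝ, x ∈ Ioo (1 : ℝ) 2 → f x - c = 0 := by
    refine isOpen_Ioo.ae_eq_zero_of_integral_contDiff_smul_eq_zero
      (f := fun x => f x - c) (hf.1.sub (integrableOn_const (by simp))).locallyIntegrableOn ?_
    intro ψ hψ hψc hψs
    set n := ∫ r in (1 : ℝ)..2, ψ r with hn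
    have hχd' : ContDiff ℝ ∞ χ := hχd
    -- Subtracting this multiple of `χ` makes the integral of `ψ` vanish, so the difference is the
    -- derivative of a test function and is annihilated by `f`.
    have hc1 : ContDiff ℝ ∞ (fun x => ψ x - n / m * χ x) := hψ.sub (contDiff_const.mul hχd')
    have hsub : tsupport (fun x => ψ x - n / m * χ x) ⊆ tsupport ψ ∪ tsupport χ := by
      refine closure_minimal (fun x hx => ?_)
        ((isClosed_tsupport ψ).union (isClosed_tsupport χ))
      by_contra hxn
      rw [mem_union, not_or] at hxn
      apply hx
      change ψ x - n / m * χ x = 0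
      rw [image_eq_zero_of_notMem_tsupport hxn.1, image_eq_zero_of_notMem_tsupport hxn.2]
      ring
    have hc2 : HasCompactSupport (fun x => ψ x - n / m * χ x) :=
      IsCompact.of_isClosed_subset (hψc.isCompact.union hχc.isCompact) (isClosed_tsupport _) hsub
    have h0 : ∫ r in (1 : ℝ)..2, (ψ r - n / m * χ r) = 0 := by
      rw [intervalIntegral.integral_sub (hψ.continuous.intervalIntegrable _ _)
        ((hχd.continuous.intervalIntegrable _ _).const_mul _),
        intervalIntegral.integral_const_mul, ← hm, ← hn]
      field_simp
      ring
    obtain ⟨φ, p1, p2, p3, p4⟩ :=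
      exists_test_primitive hc1 hc2 (hsub.trans (union_subset hψs hχs)) h0
    have hw := hf.2.2 φ p1 p2 p3
    rw [p4] at hw
    have i1 := integrable_mul_test hf.1 hψ.continuous hψc
    have i2 := integrable_mul_test hf.1 hχd.continuous hχc
    have i3 : IntegrableOn ψ (Ioo (1 : ℝ) 2) :=
      (hψ.continuous.integrable_of_hasCompactSupport hψc).integrableOn
    have hw' : (∫ r in Ioo (1 : ℝ) 2, f r * ψ r) =
        n / m * ∫ r in Ioo (1 : ℝ) 2, f r * χ r := by
      have e : ∀ r, f r * (ψ r - n / m * χ r) = f r * ψ r - n / m * (f r * χ r) := fun r => by ring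
      simp only [e] at hw
      rw [integral_sub i1 (i2.const_mul _), integral_const_mul] at hw
      simp only [Pi.zero_apply, zero_mul, integral_zero, neg_zero] at hw
      linarith
    have hres : ∫ x, ψ x • (f x - c) = ∫ x in Ioo (1 : ℝ) 2, ψ x • (f x - c) := by
      refine (setIntegral_eq_integral_of_forall_compl_eq_zero fun x hx => ?_).symm
      rw [image_eq_zero_of_notMem_tsupport fun h => hx (hψs h), zero_smul]
    have e : ∀ r, ψ r • (f r - c) = f r * ψ r - c * ψ r := fun r => by
      rw [smul_eq_mul]; ring
    rw [hres]
    simp only [e]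
    rw [integral_sub i1 (i3.const_mul _), integral_const_mul, hw', hconv ψ, ← hn, hcdef]
    field_simp
    ring
  rw [EventuallyEq, ae_restrict_iff' measurableSet_Ioo]
  filter_upwards [key] with x hx hxI
  linarith [hx hxI]

lemma intervalIntegrable_of_Ioo {g : ℝ → ℝ} (hg : IntegrableOn g (Ioo (1 : ℝ) 2)) :
    IntervalIntegrable g volume 1 2 := by
  rwa [intervalIntegrable_iff_integrableOn_Ioo_of_le one_le_two]

lemma continuousOn_primitive_Icc {g : ℝ → ℝ} (hg : IntegrableOn g (Ioo (1 : ℝ) 2)) :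
    ContinuousOn (fun x => ∫ t in (1 : ℝ)..x, g t) (Icc 1 2) := by
  have h := ((intervalIntegrable_of_Ioo hg).absolutelyContinuousOnInterval_intervalIntegral
    (c := 1) left_mem_uIcc).continuousOn
  rwa [uIcc_of_le one_le_two] at h

/-- As `g` is merely integrable, the primitive is only absolutely continuous; integration by parts
still holds, and the test function has no boundary values. -/
lemma hasWeakDeriv_primitive {g : ℝ → ℝ} (hg : IntegrableOn g (Ioo (1 : ℝ) 2)) :
    HasWeakDeriv (fun x => ∫ t in (1 : ℝ)..x, g t) g := by
  have hi := intervalIntegrable_of_Ioo hg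
  refine ⟨((continuousOn_primitive_Icc hg).integrableOn_Icc).mono_set Ioo_subset_Icc_self, hg,
    fun φ h1 h2 h3 => ?_⟩
  have hac := hi.absolutelyContinuousOnInterval_intervalIntegral (c := 1) left_mem_uIcc
  have hφ : AbsolutelyContinuousOnInterval φ 1 2 :=
    ContDiffOn.absolutelyContinuousOnInterval (h1.of_le (by norm_num)).contDiffOn
  have hparts := hac.integral_mul_deriv_eq_deriv_mul hφ
  have hφ2 : φ 2 = 0 := image_eq_zero_of_notMem_tsupport fun h => lt_irrefl _ (h3 h).2
  have hφ1 : φ 1 = 0 := image_eq_zero_of_notMem_tsupport fun h => lt_irrefl _ (h3 h).1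
  rw [← integral_Ioc_eq_integral_Ioo, ← integral_Ioc_eq_integral_Ioo,
    ← intervalIntegral.integral_of_le one_le_two, ← intervalIntegral.integral_of_le one_le_two,
    hparts, hφ1, hφ2, mul_zero, mul_zero, sub_zero, zero_sub, neg_inj]
  refine intervalIntegral.integral_congr_ae ?_
  filter_upwards [hi.ae_hasDerivAt_integral] with x hx hxI
  rw [(hx (uIoc_subset_uIcc hxI) 1 left_mem_uIcc).deriv]

/-- A function with a weak derivative on `I` is almost everywhere a primitive of it. -/
lemma HasWeakDeriv.exists_primitive {f g : ℝ → ℝ} (h : HasWeakDeriv f g) :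
    ∃ c : ℝ, f =ᵐ[volume.restrict (Ioo (1 : ℝ) 2)] fun x => c + ∫ t in (1 : ℝ)..x, g t := by
  have hz := h.add ((hasWeakDeriv_primitive h.2.1).smul (-1))
  have e : g + (-1 : ℝ) • g = 0 := by simp
  rw [e] at hz
  obtain ⟨c, hc⟩ := ae_eq_const_of_weakDeriv_zero hz
  refine ⟨c, ?_⟩
  filter_upwards [hc] with x hx
  simp only [Pi.add_apply, Pi.smul_apply, smul_eq_mul] at hx
  linarith

lemma HasWeakDeriv.exists_isContRep {f g : ℝ → ℝ} (h : HasWeakDeriv f g) :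
    ∃ w, IsContRep w f := by
  obtain ⟨c, hc⟩ := h.exists_primitive
  exact ⟨_, continuousOn_const.add (continuousOn_primitive_Icc h.2.1), hc.symm⟩

/-- Almost everywhere equality of continuous functions on `[1, 2]` is equality, endpoints included.
This makes the choice in `contRep` harmless and traces meaningful. -/
lemma IsContRep.eqOn {f g w : ℝ → ℝ} (hf : IsContRep f w) (hg : IsContRep g w) :
    EqOn f g (Icc 1 2) := by
  refine Measure.eqOn_Icc_of_ae_eq volume (by norm_num) ?_ hf.1 hg.1
  rw [← restrict_Ioo_eq_restrict_Icc]
  exact hf.2.trans hg.2.symm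

lemma isContRep_contRep {w : ℝ → ℝ} (h : ∃ f, IsContRep f w) : IsContRep (contRep w) w := by
  rw [contRep, dif_pos h]
  exact h.choose_spec

lemma isContRep_D {k : ℕ} (u : sobolev k) (j : Fin k) : IsContRep (D u j) (u.1 j.castSucc) :=
  isContRep_contRep (u.2 j).exists_isContRep

lemma continuousOn_D {k : ℕ} (u : sobolev k) (j : Fin k) : ContinuousOn (D u j) (Icc 1 2) :=
  (isContRep_D u j).1

lemma D_eq_zero_of_vanishesAt {k : ℕ} (u : sobolev k) (j : Fin k) {r : ℝ} (hr : r ∈ Icc (1 : ℝ) 2)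
    (h : VanishesAt (u.1 j.castSucc) r) : D u j r = 0 := by
  obtain ⟨f, hf, hfr⟩ := h
  rw [(isContRep_D u j).eqOn hf hr, hfr]

/-- A continuous function with a continuous weak derivative is classically differentiable. -/
lemma HasWeakDeriv.hasDerivAt {f g : ℝ → ℝ} (h : HasWeakDeriv f g)
    (hf : ContinuousOn f (Icc 1 2)) (hg : ContinuousOn g (Icc 1 2)) {r : ℝ}
    (hr : r ∈ Ioo (1 : ℝ) 2) : HasDerivAt f (g r) r := by
  obtain ⟨c, hc⟩ := h.exists_primitive
  have heq : EqOn f (fun x => c + ∫ t in (1 : ℝ)..x, g t) (Icc 1 2) :=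
    IsContRep.eqOn (w := f) ⟨hf, EventuallyEq.rfl⟩
      ⟨continuousOn_const.add (continuousOn_primitive_Icc h.2.1), hc.symm⟩
  have hnhds : Icc (1 : ℝ) 2 ∈ 𝓝 r := Icc_mem_nhds hr.1 hr.2
  have hgr : ContinuousAt g r := hg.continuousAt hnhds
  have hint : IntervalIntegrable g volume 1 r :=
    (hg.mono (by rw [uIcc_of_le hr.1.le]; exact Icc_subset_Icc_right hr.2.le)).intervalIntegrable
  have hmeas : StronglyMeasurableAtFilter g (𝓝 r) :=
    (hg.mono Ioo_subset_Icc_self).stronglyMeasurableAtFilter isOpen_Ioo r hr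
  have hd := (intervalIntegral.integral_hasDerivAt_right hint hmeas hgr).const_add c
  exact hd.congr_of_eventuallyEq (heq.eventuallyEq_of_mem hnhds)

/-- The continuous representatives of successive weak derivatives are classical derivatives. -/
lemma hasDerivAt_D {k : ℕ} (u : sobolev k) (i j : Fin k) (hij : (i : ℕ) + 1 = j) {r : ℝ}
    (hr : r ∈ Ioo (1 : ℝ) 2) : HasDerivAt (D u i) (D u j r) r := by
  have e : i.succ = j.castSucc := by ext; simpa using hij
  have h := u.2 i
  rw [e] at h
  exact (h.congr (isContRep_D u i).2.symm (isContRep_D u j).2.symm).hasDerivAt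
    (continuousOn_D u i) (continuousOn_D u j) hr

/-! ### Estimates for steady states at large voltage -/

/-- The mean value inequality on an interval of length one, so no length factor appears. With `C =
0` it expresses a conservation law. -/
lemma abs_sub_le_of_abs_hasDerivAt_le {f f' : ℝ → ℝ} {C : ℝ} (hf : ContinuousOn f (Icc 1 2))
    (hd : ∀ r ∈ Ioo (1 : ℝ) 2, HasDerivAt f (f' r) r) (hC : ∀ r ∈ Ioo (1 : ℝ) 2, |f' r| ≤ C)
    {x y : ℝ} (hx : x ∈ Icc (1 : ℝ) 2) (hy : y ∈ Icc (1 : ℝ) 2) : |f y - f x| ≤ C := by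
  have hC0 : 0 ≤ C := (abs_nonneg _).trans (hC (3 / 2) (by norm_num))
  wlog hxy : x ≤ y generalizing x y
  · rw [abs_sub_comm]
    exact this hy hx (le_of_not_ge hxy)
  rcases hxy.eq_or_lt with rfl | hlt
  · simpa using hC0
  obtain ⟨c, hc, hcs⟩ := exists_hasDerivAt_eq_slope f f' hlt
    (hf.mono (Icc_subset_Icc hx.1 hy.2))
    (fun r hr => hd r ⟨hx.1.trans_lt hr.1, hr.2.trans_le hy.2⟩)
  have h1 : f y - f x = f' c * (y - x) := by
    rw [hcs]
    field_simp [sub_ne_zero.2 hlt.ne']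
  rw [h1, abs_mul, abs_of_pos (sub_pos.2 hlt)]
  have h2 := hC c ⟨hx.1.trans_lt hc.1, hc.2.trans_le hy.2⟩
  have h3 : y - x ≤ 1 := by linarith [hx.1, hy.2]
  nlinarith [abs_nonneg (f' c)]

lemma hasDerivAt_H {r : ℝ} (hr : r ≠ 0) : HasDerivAt H (dH r) r := by
  have h := ((hasDerivAt_inv hr).const_sub 1).const_mul 2
  have e : H = fun x => 2 * (1 - x⁻¹) := by ext x; simp [H]
  rw [e]
  convert! h using 1
  simp only [dH]
  field_simp

lemma continuousOn_dH : ContinuousOn dH (Icc 1 2) :=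
  continuousOn_const.div (continuousOn_id.pow 2) fun r hr => by
    have : (0 : ℝ) < r := by linarith [hr.1]
    positivity

lemma continuousOn_exp_H (lam : ℝ) :
    ContinuousOn (fun r => Real.exp (-(lam / 2) * H r)) (Icc 1 2) := fun r hr =>
  (((hasDerivAt_H (by linarith [hr.1] : r ≠ 0)).const_mul _).exp).continuousAt.continuousWithinAt

lemma continuousOn_dPhi (lam : ℝ) (u : X) : ContinuousOn (dPhi lam u) (Icc 1 2) :=
  (continuousOn_D _ _).add (continuousOn_const.mul continuousOn_dH)

lemma continuousOn_rhoI (u : X) : ContinuousOn (rhoI u) (Icc 1 2) := continuousOn_D _ _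

lemma continuousOn_rhoE (lam : ℝ) (u : X) : ContinuousOn (rhoE lam u) (Icc 1 2) :=
  (continuousOn_D _ _).mul (continuousOn_exp_H lam)

lemma rhoI_one (u : X) : rhoI u 1 = 0 :=
  D_eq_zero_of_vanishesAt _ _ (by norm_num) u.2.1

lemma rhoE_one (lam : ℝ) (u : X) : rhoE lam u 1 = 0 := by
  have : D (elecOf u) 0 1 = 0 := D_eq_zero_of_vanishesAt _ _ (by norm_num) u.2.2.1
  rw [rhoE, this, zero_mul]

lemma hasDerivAt_rhoE (lam : ℝ) (u : X) {r : ℝ} (hr : r ∈ Ioo (1 : ℝ) 2) :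
    HasDerivAt (rhoE lam u) (Real.exp (-(lam / 2) * H r) *
      (D (elecOf u) 1 r - lam / 2 * dH r * D (elecOf u) 0 r)) r := by
  have h1 := hasDerivAt_D (elecOf u) 0 1 rfl hr
  have h2 := ((hasDerivAt_H (by linarith [hr.1] : r ≠ 0)).const_mul (-(lam / 2))).exp
  convert! h1.mul h2 using 1
  ring

/-- The quantity `r² ∂_r Φ` differs from its harmonic part `2λ` by at most a multiple of the
space charge. -/
lemma IsSteadyState.abs_dPhi_sub_le {p : Params} {lam M : ℝ} {u : X} (hs : IsSteadyState p lam u)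
    (hM : ∀ r ∈ Icc (1 : ℝ) 2, |rhoI u r - rhoE lam u r| ≤ M) {r : ℝ} (hr : r ∈ Icc (1 : ℝ) 2) :
    |r ^ 2 * dPhi lam u r - 2 * lam| ≤ 4 * M := by
  have hV1 : D (potOf u) 0 1 = 0 := D_eq_zero_of_vanishesAt _ _ (by norm_num) u.2.2.2.1
  have hV2 : D (potOf u) 0 2 = 0 := D_eq_zero_of_vanishesAt _ _ (by norm_num) u.2.2.2.2
  -- Rolle's theorem supplies a zero of `∂_rV`, from which `r² ∂_rV` is controlled by its
  -- derivative, the weighted space charge; the constant 4 bounds `r²`.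
  obtain ⟨ξ, hξ, hξ0⟩ := exists_hasDerivAt_eq_zero (f' := D (potOf u) 1) one_lt_two
    (continuousOn_D (potOf u) 0) (hV1.trans hV2.symm)
    (fun x hx => hasDerivAt_D (potOf u) 0 1 rfl hx)
  have hcont : ContinuousOn (fun r => r ^ 2 * D (potOf u) 1 r) (Icc 1 2) :=
    (continuousOn_id.pow 2).mul (continuousOn_D _ _)
  have hcont' : ContinuousOn (fun r => r ^ 2 * (D (ionOf u) 0 r
      - Real.exp (-(lam / 2) * H r) * D (elecOf u) 0 r)) (Icc 1 2) :=
    (continuousOn_id.pow 2).mul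
      ((continuousOn_D _ _).sub ((continuousOn_exp_H lam).mul (continuousOn_D _ _)))
  have hb := abs_sub_le_of_abs_hasDerivAt_le (C := 4 * M) hcont
    (fun x hx => hs.eq3.hasDerivAt hcont hcont' hx) (fun x hx => by
      have h := hM x (Ioo_subset_Icc_self hx)
      rw [rhoI, rhoE, mul_comm (D (elecOf u) 0 x)] at h
      rw [abs_mul, abs_of_nonneg (sq_nonneg x)]
      have hx4 : x ^ 2 ≤ 4 := by nlinarith [hx.1, hx.2]
      exact mul_le_mul hx4 h (abs_nonneg _) (by norm_num)) (Ioo_subset_Icc_self hξ) hr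
  have hr0 : r ≠ 0 := by linarith [hr.1]
  have e : r ^ 2 * dPhi lam u r - 2 * lam = r ^ 2 * D (potOf u) 1 r := by
    simp only [dPhi, dH]
    field_simp
    ring
  rw [e]
  simpa [hξ0] using hb

/-! ### Ion and electron fluxes, and the conserved current -/

/-- The ion flux `k_i r² ρ_i ∂_r Φ`. -/
def ionFlux (p : Params) (lam : ℝ) (u : X) (r : ℝ) : ℝ :=
  p.ki * (r ^ 2 * D (ionOf u) 0 r * dPhi lam u r)

/-- The electron flux `r² (∂_r ρ_e + ρ_e ∂_r Φ)`. -/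
def elecFlux (lam : ℝ) (u : X) (r : ℝ) : ℝ :=
  Real.exp (-(lam / 2) * H r) * (r ^ 2 * D (elecOf u) 1 r
    + (lam + r ^ 2 * D (potOf u) 1 r) * D (elecOf u) 0 r)

lemma continuousOn_ionFlux (p : Params) (lam : ℝ) (u : X) :
    ContinuousOn (ionFlux p lam u) (Icc 1 2) :=
  continuousOn_const.mul
    (((continuousOn_id.pow 2).mul (continuousOn_D _ _)).mul (continuousOn_dPhi lam u))

lemma continuousOn_elecFlux (lam : ℝ) (u : X) : ContinuousOn (elecFlux lam u) (Icc 1 2) :=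
  (continuousOn_exp_H lam).mul (((continuousOn_id.pow 2).mul (continuousOn_D _ _)).add
    ((continuousOn_const.add ((continuousOn_id.pow 2).mul (continuousOn_D _ _))).mul
      (continuousOn_D _ _)))

lemma continuousOn_h_dPhi (p : Params) {lam : ℝ} {u : X}
    (hpos : ∀ r ∈ Icc (1 : ℝ) 2, 0 < dPhi lam u r) :
    ContinuousOn (fun r => p.h |dPhi lam u r|) (Icc 1 2) := by
  have habs : ContinuousOn (fun r => |dPhi lam u r|) (Icc 1 2) := (continuousOn_dPhi lam u).abs
  exact (continuousOn_const.mul habs).mul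
    (continuousOn_const.div habs fun r hr => (abs_pos.2 (hpos r hr).ne').ne').rexp

lemma IsSteadyState.hasDerivAt_ionFlux {p : Params} {lam : ℝ} {u : X} (hs : IsSteadyState p lam u)
    (hpos : ∀ r ∈ Icc (1 : ℝ) 2, 0 < dPhi lam u r) {r : ℝ} (hr : r ∈ Ioo (1 : ℝ) 2) :
    HasDerivAt (ionFlux p lam u) (p.ke * (r ^ 2 * p.h (dPhi lam u r) * rhoE lam u r)) r := by
  have h := hs.eq1.hasDerivAt (continuousOn_ionFlux p lam u)
    ((continuousOn_id.pow 2).mul (((continuousOn_const.mul (continuousOn_h_dPhi p hpos)).mul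
      (continuousOn_exp_H lam)).mul (continuousOn_D _ _))) hr
  convert! h using 1
  simp only [abs_of_pos (hpos r (Ioo_subset_Icc_self hr)), rhoE]
  ring

/-- Undoing the substitution `R_e = e^{λH/2} ρ_e` restores divergence form: since `r² ∂_rH = 2`, all
drift and zeroth-order terms cancel except ionization. -/
lemma IsSteadyState.hasDerivAt_elecFlux {p : Params} {lam : ℝ} {u : X}
    (hs : IsSteadyState p lam u) (hpos : ∀ r ∈ Icc (1 : ℝ) 2, 0 < dPhi lam u r) {r : ℝ}
    (hr : r ∈ Ioo (1 : ℝ) 2) :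
    HasDerivAt (elecFlux lam u) (-(r ^ 2 * p.h (dPhi lam u r) * rhoE lam u r)) r := by
  have hr0 : r ≠ 0 := by linarith [hr.1]
  have hS := hs.eq2.hasDerivAt ((continuousOn_id.pow 2).mul (continuousOn_D _ _))
    ((continuousOn_id.pow 2).mul (((continuousOn_D _ _).mul (continuousOn_D _ _)).neg.add
      ((((((continuousOn_const.mul (continuousOn_D _ _)).mul continuousOn_dH).sub
        ((continuousOn_D _ _).add ((continuousOn_const.div continuousOn_id fun x hx => by
          simp only [id]; linarith [hx.1]).mul (continuousOn_D _ _)))).add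
        (continuousOn_const.mul (continuousOn_dH.pow 2))).sub (continuousOn_h_dPhi p hpos)).mul
      (continuousOn_D _ _)))) hr
  have hE := ((hasDerivAt_H hr0).const_mul (-(lam / 2))).exp
  have hT := ((hasDerivAt_pow 2 r).mul (hasDerivAt_D (potOf u) 1 2 rfl hr)).const_add lam
  have h := hE.mul (hS.add (hT.mul (hasDerivAt_D (elecOf u) 0 1 rfl hr)))
  convert! h using 1
  simp only [abs_of_pos (hpos r (Ioo_subset_Icc_self hr)), rhoE, dH, Pi.add_apply, Pi.mul_apply]
  field_simp
  ring

/-- The boundary condition at the cathode, in terms of the fluxes. -/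
lemma IsSteadyState.elecFlux_two {p : Params} {lam : ℝ} {u : X} (hs : IsSteadyState p lam u) :
    elecFlux lam u 2 = p.γ * (ionFlux p lam u 2 / p.ke) := by
  have h4 := hs.eq4
  have hke := p.ke_pos
  have hH : H 2 = 1 := by norm_num [H]
  have hd : dH 2 = 1 / 2 := by norm_num [dH]
  have hexp : Real.exp (-(lam / 2) * 1) * Real.exp (lam / 2 * 1) = 1 := by
    rw [← Real.exp_add]; simp
  rw [hH, hd] at h4
  rw [elecFlux, ionFlux, hH]
  -- The boundary condition multiplied by `r² = 4`.
  have e : 2 ^ 2 * D (elecOf u) 1 2 + (lam + 2 ^ 2 * D (potOf u) 1 2) * D (elecOf u) 0 2 =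
      4 * (p.γ * (p.ki / p.ke) * Real.exp (lam / 2 * 1) * dPhi lam u 2 * D (ionOf u) 0 2) := by
    linarith
  rw [e]
  calc _ = Real.exp (-(lam / 2) * 1) * Real.exp (lam / 2 * 1) *
        (4 * (p.γ * (p.ki / p.ke) * dPhi lam u 2 * D (ionOf u) 0 2)) := by ring
    _ = _ := by rw [hexp]; ring

/-- The total current `elecFlux + ionFlux / k_e` is constant. -/
lemma IsSteadyState.elecFlux_one {p : Params} {lam : ℝ} {u : X} (hs : IsSteadyState p lam u)
    (hpos : ∀ r ∈ Icc (1 : ℝ) 2, 0 < dPhi lam u r) :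
    elecFlux lam u 1 = (1 + p.γ) * (ionFlux p lam u 2 / p.ke) := by
  have hke := p.ke_pos
  have hb := abs_sub_le_of_abs_hasDerivAt_le (C := 0) (x := 1) (y := 2)
    (f := fun r => elecFlux lam u r + ionFlux p lam u r / p.ke) (f' := fun _ => 0)
    ((continuousOn_elecFlux lam u).add ((continuousOn_ionFlux p lam u).div_const _))
    (fun r hr => by
      convert! (hs.hasDerivAt_elecFlux hpos hr).add ((hs.hasDerivAt_ionFlux hpos hr).div_const p.ke)
        using 1
      field_simp
      ring) (by simp) (by norm_num) (by norm_num)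
  have h1 : ionFlux p lam u 1 = 0 := by
    have := rhoI_one u
    rw [rhoI] at this
    rw [ionFlux, this]
    ring
  have h0 := sub_eq_zero.1 (abs_nonpos_iff.1 hb)
  simp only [h1, hs.elecFlux_two, zero_div] at h0
  linarith

/-- Splits the flux into diffusion and drift; the first factor after `r²` is the derivative in
`hasDerivAt_rhoE`. -/
lemma elecFlux_eq (lam : ℝ) (u : X) {r : ℝ} (hr : r ≠ 0) :
    elecFlux lam u r = r ^ 2 * (Real.exp (-(lam / 2) * H r) *
      (D (elecOf u) 1 r - lam / 2 * dH r * D (elecOf u) 0 r)) +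
      r ^ 2 * dPhi lam u r * rhoE lam u r := by
  simp only [elecFlux, dPhi, rhoE, dH]
  field_simp
  ring

/-- By `0 ≤ 1 - e^{-b/x} ≤ b/x`, the defect `a x - h(x)` lies in `[0, ab]` however strong the field
`x` is. -/
lemma Params.sq_mul_h_bounds (p : Params) {x r : ℝ} (hx : 0 < x) :
    0 ≤ p.a * (r ^ 2 * x) - r ^ 2 * p.h x ∧
      p.a * (r ^ 2 * x) - r ^ 2 * p.h x ≤ r ^ 2 * (p.a * p.b) := by
  have ha := p.a_pos
  have hb := p.b_pos
  have h1 : Real.exp (-p.b / x) ≤ 1 :=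
    Real.exp_le_one_iff.2 (div_nonpos_of_nonpos_of_nonneg (by linarith) hx.le)
  have h2 : -p.b / x + 1 ≤ Real.exp (-p.b / x) := Real.add_one_le_exp _
  have h3 : x * (1 - Real.exp (-p.b / x)) ≤ p.b := by
    calc x * (1 - Real.exp (-p.b / x)) ≤ x * (p.b / x) := by
          refine mul_le_mul_of_nonneg_left ?_ hx.le
          rw [neg_div] at h2 ⊢
          linarith
      _ = p.b := by field_simp
  have e : p.a * (r ^ 2 * x) - r ^ 2 * p.h x =
      r ^ 2 * (p.a * (x * (1 - Real.exp (-p.b / x)))) := by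
    simp only [Params.h]; ring
  rw [e]
  have h4 : 0 ≤ 1 - Real.exp (-p.b / x) := by linarith
  exact ⟨by positivity, by gcongr⟩

/-- The ion current at the cathode is bounded in terms of the electron density alone, unless
the limiting Townsend criterion `γ = e^{-a} (1 + γ)` holds. -/
lemma IsSteadyState.abs_ionFlux_two_le {p : Params} {lam M : ℝ} {u : X}
    (hs : IsSteadyState p lam u) (hpos : ∀ r ∈ Icc (1 : ℝ) 2, 0 < dPhi lam u r)
    (hM : ∀ r ∈ Icc (1 : ℝ) 2, |rhoE lam u r| ≤ M) :
    |ionFlux p lam u 2 / p.ke * (Real.exp (p.a * 2) * p.γ - Real.exp (p.a * 1) * (1 + p.γ))| ≤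
      Real.exp (p.a * 2) * (M * (4 * (p.a * p.b) + 4 * p.a ^ 2 + 8 * p.a)) := by
  have ha := p.a_pos
  have hb := p.b_pos
  have hM0 : 0 ≤ M := (abs_nonneg _).trans (hM 1 (by norm_num))
  -- The weight `e^{ar}` produces `a E`, whose diffusive part `a r² ∂_rρ_e` is removed by the
  -- correction `-a r² ρ_e`. What remains is `ρ_e` times the bounded defect `r² (a ∂_rΦ - h)` and
  -- the terms `a² r²` and `2ar`, which account for the three constants.
  have hbound := abs_sub_le_of_abs_hasDerivAt_le (x := 1) (y := 2)
    (C := Real.exp (p.a * 2) * (M * (4 * (p.a * p.b) + 4 * p.a ^ 2 + 4 * p.a)))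
    (f := fun r => Real.exp (p.a * r) * (elecFlux lam u r - p.a * (r ^ 2 * rhoE lam u r)))
    (f' := fun r => Real.exp (p.a * r) * (rhoE lam u r *
      ((p.a * (r ^ 2 * dPhi lam u r) - r ^ 2 * p.h (dPhi lam u r)) - p.a ^ 2 * r ^ 2
        - 2 * p.a * r)))
    ((by fun_prop : Continuous fun r => Real.exp (p.a * r)).continuousOn.mul
      ((continuousOn_elecFlux lam u).sub (continuousOn_const.mul
        ((continuousOn_id.pow 2).mul (continuousOn_rhoE lam u)))))
    (fun r hr => by
      have hr0 : r ≠ 0 := by linarith [hr.1]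
      have h1 := ((hasDerivAt_id r).const_mul p.a).exp
      have h2 := ((hasDerivAt_pow 2 r).mul (hasDerivAt_rhoE lam u hr)).const_mul p.a
      convert! h1.mul ((hs.hasDerivAt_elecFlux hpos hr).sub h2) using 1
      simp only [Pi.sub_apply, Pi.mul_apply, elecFlux_eq lam u hr0, id]
      push_cast
      ring)
    (fun r hr => by
      have hrI := Ioo_subset_Icc_self hr
      obtain ⟨l1, l2⟩ := p.sq_mul_h_bounds (r := r) (hpos r hrI)
      have hr2 : r ^ 2 ≤ 4 := by nlinarith [hr.1, hr.2]
      have hr1 := hr.1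
      have hr3 := hr.2
      rw [abs_mul, abs_mul, Real.abs_exp]
      gcongr
      · exact hM r hrI
      · rw [abs_le]
        have e1 : r ^ 2 * (p.a * p.b) ≤ 4 * (p.a * p.b) := by gcongr
        have e2 : p.a ^ 2 * r ^ 2 ≤ 4 * p.a ^ 2 := by nlinarith [sq_nonneg p.a]
        have e3 : 2 * p.a * r ≤ 4 * p.a := by nlinarith
        have e4 : 0 ≤ p.a ^ 2 * r ^ 2 := by positivity
        have e5 : 0 ≤ 2 * p.a * r := by positivity
        have e6 : 0 ≤ p.a * p.b := by positivity
        have e7 : 0 ≤ p.a ^ 2 := by positivity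
        constructor <;> linarith)
    (by norm_num) (by norm_num)
  simp only [hs.elecFlux_two, hs.elecFlux_one hpos, rhoE_one] at hbound
  have h2 := hM 2 (by norm_num)
  -- The correction vanishes at `r = 1`; its value at `r = 2` contributes the extra `4a` that raises
  -- `4a` to `8a`.
  have e : ionFlux p lam u 2 / p.ke *
        (Real.exp (p.a * 2) * p.γ - Real.exp (p.a * 1) * (1 + p.γ)) =
      (Real.exp (p.a * 2) * (p.γ * (ionFlux p lam u 2 / p.ke) - p.a * (2 ^ 2 * rhoE lam u 2)) -
        Real.exp (p.a * 1) * ((1 + p.γ) * (ionFlux p lam u 2 / p.ke) - p.a * (1 ^ 2 * 0))) +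
      Real.exp (p.a * 2) * (4 * p.a) * rhoE lam u 2 := by ring
  rw [e]
  refine (abs_add_le _ _).trans ((add_le_add hbound (?_ :
    _ ≤ Real.exp (p.a * 2) * (4 * p.a) * M)).trans (le_of_eq (by ring)))
  rw [abs_mul, abs_of_pos (by positivity)]
  gcongr

/-! ### Norms and decay at large voltage -/

lemma abs_le_c0Norm {f : ℝ → ℝ} (hf : ContinuousOn f (Icc 1 2)) {r : ℝ}
    (hr : r ∈ Icc (1 : ℝ) 2) : |f r| ≤ c0Norm f :=
  le_csSup (isCompact_Icc.bddAbove_image hf.abs) (mem_image_of_mem _ hr)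

lemma c0Norm_nonneg (f : ℝ → ℝ) : 0 ≤ c0Norm f :=
  Real.sSup_nonneg (by rintro _ ⟨r, -, rfl⟩; exact abs_nonneg _)

lemma l1Norm_nonneg (f : ℝ → ℝ) : 0 ≤ l1Norm f := integral_nonneg fun _ => abs_nonneg _

/-- Bounded nonnegative steady states decay like `1 / λ` at large voltage `λ`. -/
theorem exists_decay_of_bounded (p : Params) (hγ : p.γ * (1 + p.γ)⁻¹ ≠ Real.exp (-p.a)) (M : ℝ) :
    ∃ C Λ : ℝ, 0 < Λ ∧ ∀ lam u, Λ ≤ lam → IsSteadyState p lam u →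
      (∀ r ∈ Ioc (1 : ℝ) 2, 0 < rhoI u r ∧ 0 < rhoE lam u r) →
      c0Norm (rhoI u) + c0Norm (rhoE lam u) ≤ M →
      c0Norm (rhoI u) + l1Norm (rhoE lam u) ≤ C / lam := by
  have ha := p.a_pos
  have hb := p.b_pos
  have hki := p.ki_pos
  have hke := p.ke_pos
  have hγ0 := p.γ_pos
  set δ := |Real.exp (p.a * 2) * p.γ - Real.exp (p.a * 1) * (1 + p.γ)| with hδ
  -- Dividing by `e^a`, vanishing would mean `e^a γ = 1 + γ`, which `hγ` excludes.
  have hδ0 : 0 < δ := by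
    refine abs_pos.2 fun h => hγ ?_
    have e : Real.exp (p.a * 2) = Real.exp (p.a * 1) * Real.exp p.a := by
      rw [← Real.exp_add]; ring_nf
    rw [e, mul_assoc, ← mul_sub] at h
    have h' := (mul_eq_zero.1 h).resolve_left (Real.exp_pos _).ne'
    rw [Real.exp_neg]
    have := Real.exp_pos p.a
    field_simp
    linarith
  set B := Real.exp (p.a * 2) * (M * (4 * (p.a * p.b) + 4 * p.a ^ 2 + 8 * p.a)) / δ with hB
  -- A lower bound for `h(ℓ) / ℓ` when `ℓ ≥ 1/4`.
  set κ := p.a * Real.exp (-(4 * p.b)) with hκ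
  have hκ0 : 0 < κ := by positivity
  -- The two summands bound the ion and electron terms. The threshold `4M` gives `r² ∂_rΦ ≥ 2λ - 4M
  -- ≥ λ`, and then `λ ≥ 1` gives `∂_rΦ ≥ 1/4`.
  refine ⟨p.ke / p.ki * B + B / κ, max 1 (4 * M), by positivity, ?_⟩
  intro lam u hlam hs hρ hM
  have hlam1 : 1 ≤ lam := (le_max_left _ _).trans hlam
  have hlam4 : 4 * M ≤ lam := (le_max_right _ _).trans hlam
  have hlam0 : 0 < lam := by linarith
  have hi : ∀ r ∈ Icc (1 : ℝ) 2, 0 ≤ rhoI u r := fun r hr => by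
    rcases hr.1.eq_or_lt with rfl | h
    · exact (rhoI_one u).ge
    · exact (hρ r ⟨h, hr.2⟩).1.le
  have he : ∀ r ∈ Icc (1 : ℝ) 2, 0 ≤ rhoE lam u r := fun r hr => by
    rcases hr.1.eq_or_lt with rfl | h
    · exact (rhoE_one lam u).ge
    · exact (hρ r ⟨h, hr.2⟩).2.le
  have hiM : ∀ r ∈ Icc (1 : ℝ) 2, |rhoI u r| ≤ M := fun r hr => by
    linarith [abs_le_c0Norm (continuousOn_rhoI u) hr, c0Norm_nonneg (rhoE lam u)]
  have heM : ∀ r ∈ Icc (1 : ℝ) 2, |rhoE lam u r| ≤ M := fun r hr => by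
    linarith [abs_le_c0Norm (continuousOn_rhoE lam u) hr, c0Norm_nonneg (rhoI u)]
  -- Both densities lie in `[0, M]`, hence so does the absolute value of their difference.
  have hm : ∀ r ∈ Icc (1 : ℝ) 2, lam ≤ r ^ 2 * dPhi lam u r := fun r hr => by
    have h := hs.abs_dPhi_sub_le (M := M) (fun x hx => abs_le.2 ⟨?_, ?_⟩) hr
    · linarith [(abs_le.1 h).1]
    · linarith [hi x hx, (abs_le.1 (heM x hx)).2]
    · linarith [he x hx, (abs_le.1 (hiM x hx)).2]
  have hpos : ∀ r ∈ Icc (1 : ℝ) 2, 0 < dPhi lam u r := fun r hr =>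
    pos_of_mul_pos_right (hlam0.trans_le (hm r hr)) (sq_nonneg r)
  have hA : ionFlux p lam u 2 / p.ke ≤ B := by
    have h := hs.abs_ionFlux_two_le hpos heM
    rw [abs_mul, ← hδ] at h
    exact (le_abs_self _).trans ((le_div_iff₀ hδ0).2 h)
  have hh : ∀ r ∈ Icc (1 : ℝ) 2, lam * κ ≤ r ^ 2 * p.h (dPhi lam u r) := fun r hr => by
    have hd := hpos r hr
    have hd4 : 1 ≤ 4 * dPhi lam u r := by
      have hr2 : r ^ 2 ≤ 4 := by nlinarith [hr.1, hr.2]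
      nlinarith [hm r hr]
    have hexp : Real.exp (-(4 * p.b)) ≤ Real.exp (-p.b / dPhi lam u r) := by
      refine Real.exp_le_exp.2 ?_
      rw [neg_div, neg_le_neg_iff, div_le_iff₀ hd]
      nlinarith
    calc lam * κ ≤ r ^ 2 * dPhi lam u r * (p.a * Real.exp (-p.b / dPhi lam u r)) := by
          rw [hκ]
          exact mul_le_mul (hm r hr) (by gcongr) (by positivity) (by positivity)
      _ = r ^ 2 * p.h (dPhi lam u r) := by simp only [Params.h]; ring
  have hJ' : ∀ r ∈ Icc (1 : ℝ) 2, p.ke * (lam * κ * rhoE lam u r) ≤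
      p.ke * (r ^ 2 * p.h (dPhi lam u r) * rhoE lam u r) := fun r hr => by
    have := he r hr
    have := hh r hr
    gcongr
  have hJ'0 : ∀ r ∈ Icc (1 : ℝ) 2, 0 ≤ p.ke * (r ^ 2 * p.h (dPhi lam u r) * rhoE lam u r) :=
    fun r hr => le_trans (by have := he r hr; positivity) (hJ' r hr)
  have hcJ := continuousOn_ionFlux p lam u
  have hmono : MonotoneOn (ionFlux p lam u) (Icc 1 2) := by
    refine monotoneOn_of_deriv_nonneg (convex_Icc 1 2) hcJ ?_ ?_ <;> rw [interior_Icc]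
    · exact fun r hr => (hs.hasDerivAt_ionFlux hpos hr).differentiableAt.differentiableWithinAt
    · intro r hr
      rw [(hs.hasDerivAt_ionFlux hpos hr).deriv]
      exact hJ'0 r (Ioo_subset_Icc_self hr)
  -- Pointwise, `k_i λ ρ_i ≤ J(r) ≤ J(2) ≤ k_e B` by monotonicity of `J`.
  have hion : c0Norm (rhoI u) ≤ p.ke / p.ki * B / lam := by
    refine csSup_le ((nonempty_Icc.2 one_le_two).image _) ?_
    rintro _ ⟨r, hr, rfl⟩
    have h1 := hmono hr (right_mem_Icc.2 one_le_two) hr.2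
    have h2 : ionFlux p lam u 2 ≤ p.ke * B := by
      rwa [div_le_iff₀ hke, mul_comm] at hA
    have h3 : p.ki * (lam * rhoI u r) ≤ ionFlux p lam u r := by
      have := hm r hr
      have := hi r hr
      calc p.ki * (lam * rhoI u r) ≤ p.ki * (r ^ 2 * dPhi lam u r * rhoI u r) := by gcongr
        _ = ionFlux p lam u r := by simp only [ionFlux, rhoI]; ring
    simp only [abs_of_nonneg (hi r hr)]
    rw [le_div_iff₀ hlam0, div_mul_eq_mul_div, le_div_iff₀ hki]
    linarith
  -- Integrating `J' ≥ k_e λ κ ρ_e` from `J(1) = 0` controls only the integral of `ρ_e`, whence the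
  -- `L¹` norm.
  have helec : l1Norm (rhoE lam u) ≤ B / κ / lam := by
    have hce := continuousOn_rhoE lam u
    have hcint : IntervalIntegrable (rhoE lam u) volume 1 2 :=
      (by rwa [uIcc_of_le one_le_two] : ContinuousOn (rhoE lam u) (uIcc 1 2)).intervalIntegrable
    have hch : ContinuousOn (fun r => p.h (dPhi lam u r)) (Icc 1 2) :=
      (continuousOn_h_dPhi p hpos).congr fun r hr => by
        simp only [abs_of_pos (hpos r hr)]
    have hcJ' : ContinuousOn (fun r => p.ke * (r ^ 2 * p.h (dPhi lam u r) * rhoE lam u r))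
        (uIcc 1 2) := by
      rw [uIcc_of_le one_le_two]
      exact continuousOn_const.mul (((continuousOn_id.pow 2).mul hch).mul hce)
    have hftc := intervalIntegral.integral_eq_sub_of_hasDerivAt_of_le one_le_two hcJ
      (fun r hr => hs.hasDerivAt_ionFlux hpos hr) hcJ'.intervalIntegrable
    have h1 : ionFlux p lam u 1 = 0 := by
      have := rhoI_one u
      rw [rhoI] at this
      rw [ionFlux, this]
      ring
    have hle := intervalIntegral.integral_mono_on one_le_two ((hcint.const_mul _).const_mul _)
      hcJ'.intervalIntegrable hJ'
    rw [hftc, h1, sub_zero, intervalIntegral.integral_const_mul,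
      intervalIntegral.integral_const_mul] at hle
    have hl : l1Norm (rhoE lam u) = ∫ r in (1 : ℝ)..2, rhoE lam u r := by
      rw [l1Norm, intervalIntegral.integral_of_le one_le_two, integral_Ioc_eq_integral_Ioo]
      exact setIntegral_congr_fun measurableSet_Ioo fun r hr =>
        abs_of_nonneg (he r (Ioo_subset_Icc_self hr))
    rw [hl, le_div_iff₀ hlam0, le_div_iff₀ hκ0]
    refine le_trans ?_ hA
    rw [le_div_iff₀ hke]
    linarith
  calc _ ≤ p.ke / p.ki * B / lam + B / κ / lam := add_le_add hion helec
    _ = _ := by ring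

end GasDischarge

end

/-! ### Passage to the limit along the curve -/

lemma EReal.exists_eventually_lt_of_limsup_coe_lt_top {α : Type*} {l : Filter α} {f : α → ℝ}
    (h : limsup (fun s => (f s : EReal)) l < ⊤) : ∃ M : ℝ, ∀ᶠ s in l, f s < M := by
  obtain ⟨M, hM, -⟩ := EReal.lt_iff_exists_real_btwn.1 h
  exact ⟨M, (eventually_lt_of_limsup_lt hM).mono fun s hs => EReal.coe_lt_coe_iff.1 hs⟩

open GasDischarge in
theorem proposition6p1 (p : Params) (hS : HasSparkingVoltage p) (hT : Transversality p)
    (K : ℝ → ℝ × X) (hK : IsGlobalCurve p K)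
    (hγ : p.γ * (1 + p.γ)⁻¹ ≠ Real.exp (-p.a))
    (hpos : PositiveAlternative K)
    (hbdd : limsup (fun s =>
      ((c0Norm (rhoI (K s).2) + c0Norm (rhoE (K s).1 (K s).2) : ℝ) : EReal)) atTop < ⊤) :
    liminf (fun s =>
      ((c0Norm (rhoI (K s).2) + l1Norm (rhoE (K s).1 (K s).2) : ℝ) : EReal)) atTop = 0 ∧
    limsup (fun s => ((K s).1 : EReal)) atTop = ⊤ := by
  obtain ⟨M, hM⟩ := EReal.exists_eventually_lt_of_limsup_coe_lt_top hbdd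
  have hlam : limsup (fun s => ((K s).1 : EReal)) atTop = ⊤ := by
    -- If `λ` were also eventually bounded, the sum in the positivity alternative would be too.
    by_contra hne
    obtain ⟨N, hN⟩ := EReal.exists_eventually_lt_of_limsup_coe_lt_top (lt_top_iff_ne_top.2 hne)
    have hle : limsup (fun s => ((c0Norm (rhoI (K s).2) + c0Norm (rhoE (K s).1 (K s).2)
        + (K s).1 : ℝ) : EReal)) atTop ≤ ((M + N : ℝ) : EReal) :=
      limsup_le_of_le (h := by
        filter_upwards [hM, hN] with s h1 h2
        exact EReal.coe_le_coe_iff.2 (by linarith))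
    rw [hpos.2, top_le_iff] at hle
    exact EReal.coe_ne_top _ hle
  refine ⟨le_antisymm ?_ ?_, hlam⟩
  · obtain ⟨C, Λ, hΛ, hdecay⟩ := exists_decay_of_bounded p hγ M
    refine EReal.le_of_forall_lt_iff_le.1 fun ε hε => ?_
    have hε' : 0 < ε := EReal.coe_pos.1 hε
    refine liminf_le_of_frequently_le' ?_
    -- Large `λ` occurs only frequently, not eventually, which suffices for a `liminf`; exceeding `C
    -- / ε` pushes the decay bound below `ε`.
    have hfreq : ∃ᶠ s in atTop, ((max Λ (C / ε) : ℝ) : EReal) < ((K s).1 : EReal) :=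
      frequently_lt_of_lt_limsup (h := by rw [hlam]; exact EReal.coe_lt_top _)
    refine (hfreq.and_eventually (hM.and (eventually_gt_atTop 0))).mono ?_
    rintro s ⟨h1, h2, h3⟩
    have h1' := EReal.coe_lt_coe_iff.1 h1
    have hΛ' : Λ < (K s).1 := (le_max_left _ _).trans_lt h1'
    have hC' : C / ε < (K s).1 := (le_max_right _ _).trans_lt h1'
    refine EReal.coe_le_coe_iff.2
      ((hdecay _ _ hΛ'.le (hK.steady s) (hpos.1 s h3) h2.le).trans ?_)
    rw [div_le_iff₀ (hΛ.trans hΛ')]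
    rw [div_lt_iff₀ hε'] at hC'
    linarith
  · exact le_liminf_of_le (h := Eventually.of_forall fun s =>
      EReal.coe_nonneg.2 (add_nonneg (c0Norm_nonneg _) (l1Norm_nonneg _)))
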